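/- For partitions $\lambda,\mu$ with at most two parts and $\nu$ with at most three parts, let $c^{\nu}_{\lambda,\mu}$ be the Littlewood–Richardson coefficient. Define $C:\mathbb Z^6\to\mathbb Z_{\ge 0}$ by \[ C(\lambda_1,\lambda_2,\mu_1,\mu_2,\nu_1,\nu_2)=c^{(\nu_1,\nu_2,\nu_3)}_{(\lambda_1,\lambda_2),(\mu_1,\mu_2)},\qquad \nu_3:=\lambda_1+\lambda_2+\mu_1+\mu_2-\nu_1-\nu_2, \] when $\lambda_1\ge\lambda_2\ge0$, $\mu_1\ge\mu_2\ge0$ and $\nu_1\ge\nu_2\ge\nu_3\ge0$, and $C=0$ otherwise. Let $G$ be the group of all invertible linear maps $F:\mathbb Z^6\to\mathbb Z^6$ with $C\circ F=C$. In $\mathbb R^6$, put \[ b=(2,1,2,1,3,2),\quad c=(1,1,1,1,2,1),\quad f=(1,0,1,0,1,1), \] \[ d_1=(1,1,1,0,1,1),\quad e_1=(1,1,0,0,1,1),\quad g_1=(1,0,0,0,1,0), \] \[ d_2=(1,0,1,1,1,1),\quad e_2=(0,0,1,1,1,1),\quad g_2=(0,0,1,0,1,0). \] The chambers of Rassart's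 chamber complex for $C$ are the 18 convex cones generated by $b$, one of $c,f$, two of $d_1,e_2,g_1$, and two of $d_2,e_1,g_2$. Then: 1. $G$ has order $144$ and is isomorphic to $\mathfrak S_2\times(\mathfrak S_3\wr\mathfrak S_2)$. 2. $G$ (acting on $\mathbb R^6$ by linear extension) permutes the 18 chambers, and acts transitively on them. 3. The maps \[ S:(\lambda_1,\lambda_2\,|\,\mu_1,\mu_2\,|\,\nu_1,\nu_2)\mapsto(\mu_1,\mu_2\,|\,\lambda_1,\lambda_2\,|\,\nu_1,\nu_2), \] \[ U:(\lambda_1,\lambda_2\,|\,\mu_1,\mu_2\,|\,\nu_1,\nu_2)\mapsto(\nu_1-\nu_3,\nu_1-\nu_2\,|\,\mu_1,\mu_2\,|\,\nu_1,\nu_1-\lambda_2), \] \[ T:(\lambda_1,\lambda_2\,|\,\mu_1,\mu_2\,|\,\nu_1,\nu_2)\mapsto(\lambda_1,\lambda_1-\lambda_2\,|\,\mu_1,\mu_1-\mu_2\,|\,\lambda_1+\mu_1-\nu_3,\lambda_1+\mu_1-\nu_2) \] generate a group of order $12$ (the known symmetries: the $\mathfrak S_3$-symmetry, generated by $S$ and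 $U$, and the complement/duality involution $T$). The group $G$ is generated by these 12 known symmetries together with the additional symmetry \[ X:(\lambda_1,\lambda_2\,|\,\mu_1,\mu_2\,|\,\nu_1,\nu_2)\mapsto(\lambda_1+\mu_1-\nu_2,\ \lambda_2+\mu_1-\nu_2\,|\,\nu_2,\mu_2\,|\,\nu_1,\mu_1). \] -/

import Mathlib

/-- A Littlewood–Richardson tableau of skew shape `nu / lam` and content `mu`. Diagrams are drawn in
matrix coordinates (row `i` from the top, column `j` from the left), and the letters are
`0, 1, 2, …`, so that the letter `k` has to appear as many times as there are cells in the row `k`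
of `mu`. The filling is set to `0` outside of the skew shape. -/
@[ext]
structure LRTableau (lam mu nu : YoungDiagram) where
  /-- the filling -/
  entry : ℕ → ℕ → ℕ
  /-- `nu / lam` is a skew shape -/
  le : lam ≤ nu
  /-- the filling carries no information outside of the skew shape -/
  zeros : ∀ i j, (i, j) ∉ nu.cells \ lam.cells → entry i j = 0
  /-- rows weakly increase from left to right -/
  row_weak : ∀ i j j', j < j' → (i, j) ∈ nu.cells \ lam.cells →
    (i, j') ∈ nu.cells \ lam.cells → entry i j ≤ entry i j'
  /-- columns strictly increase from top to bottom -/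
  col_strict : ∀ i i' j, i < i' → (i, j) ∈ nu.cells \ lam.cells →
    (i', j) ∈ nu.cells \ lam.cells → entry i j < entry i' j
  /-- the content is `mu` -/
  content : ∀ k, ((nu.cells \ lam.cells).filter (fun c => entry c.1 c.2 = k)).card = mu.rowLen k
  /-- the lattice word condition: when the rows are read from right to left, from the top row to
  the bottom row, then at each moment (after the cell in row `i` and column `j` is read) the letter
  `k + 1` has not been read more often than the letter `k` -/
  lattice : ∀ i j k,
    ((nu.cells \ lam.cells).filter
      (fun c => (c.1 < i ∨ c.1 = i ∧ j ≤ c.2) ∧ entry c.1 c.2 = k + 1)).card ≤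
    ((nu.cells \ lam.cells).filter
      (fun c => (c.1 < i ∨ c.1 = i ∧ j ≤ c.2) ∧ entry c.1 c.2 = k)).card

/-- The Littlewood–Richardson coefficient `c^nu_{lam, mu}`: the number of Littlewood–Richardson
tableaux of shape `nu / lam` and content `mu`. -/
noncomputable def lrCoeff (lam mu nu : YoungDiagram) : ℕ := Nat.card (LRTableau lam mu nu)

/-- The Young diagram of the partition `(a, b, c)` with at most three parts `a ≥ b ≥ c ≥ 0`. -/
def diagram3 (a b c : ℕ) (hab : b ≤ a) (hbc : c ≤ b) : YoungDiagram :=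
  YoungDiagram.ofRowLens [a, b, c] (by
    rw [List.sortedGE_iff_pairwise]
    simp [hab, hbc, hbc.trans hab])

/-- `ν₃ = λ₁ + λ₂ + μ₁ + μ₂ - ν₁ - ν₂`, for `v = (λ₁, λ₂, μ₁, μ₂, ν₁, ν₂)`. -/
def nu3 (v : Fin 6 → ℤ) : ℤ := v 0 + v 1 + v 2 + v 3 - v 4 - v 5

/-- The function `C` on `ℤ⁶`, in the coordinates `v = (λ₁, λ₂, μ₁, μ₂, ν₁, ν₂)`: it is the
coefficient `c^{(ν₁, ν₂, ν₃)}_{(λ₁, λ₂), (μ₁, μ₂)}` when `λ₁ ≥ λ₂ ≥ 0`, `μ₁ ≥ μ₂ ≥ 0` and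
`ν₁ ≥ ν₂ ≥ ν₃ ≥ 0`, and `0` otherwise. -/
noncomputable def sl3LR (v : Fin 6 → ℤ) : ℕ :=
  if h : (v 1 ≤ v 0 ∧ 0 ≤ v 1) ∧ (v 3 ≤ v 2 ∧ 0 ≤ v 3) ∧
      (v 5 ≤ v 4 ∧ nu3 v ≤ v 5 ∧ 0 ≤ nu3 v) then
    lrCoeff
      (diagram3 (v 0).toNat (v 1).toNat 0 (Int.toNat_le_toNat h.1.1) (Nat.zero_le _))
      (diagram3 (v 2).toNat (v 3).toNat 0 (Int.toNat_le_toNat h.2.1.1) (Nat.zero_le _))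
      (diagram3 (v 4).toNat (v 5).toNat (nu3 v).toNat
        (Int.toNat_le_toNat h.2.2.1) (Int.toNat_le_toNat h.2.2.2.1))
  else 0

/-- The group of linear symmetries of `C`: all invertible linear maps `F : ℤ⁶ → ℤ⁶` such that
`C ∘ F = C`, under composition. -/
def lrSymmetries : Subgroup ((Fin 6 → ℤ) ≃ₗ[ℤ] (Fin 6 → ℤ)) where
  carrier := {F | sl3LR ∘ F = sl3LR}
  one_mem' := rfl
  mul_mem' := by
    intro F G hF hG
    funext v
    exact (congrFun hF (G v)).trans (congrFun hG v)
  inv_mem' := by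
    intro F hF
    funext v
    have h := congrFun hF (F⁻¹ v)
    have e : F (F⁻¹ v) = v := F.apply_symm_apply v
    simp only [Function.comp_apply, e] at h
    exact h.symm

/-- The symmetry `S : λ, μ, ν ↦ μ, λ, ν`. -/
def symS : (Fin 6 → ℤ) ≃ₗ[ℤ] (Fin 6 → ℤ) :=
  LinearEquiv.ofInvolutive
    { toFun := fun v => ![v 2, v 3, v 0, v 1, v 4, v 5]
      map_add' := by intro v w; ext i; fin_cases i <;> simp
      map_smul' := by intro a v; ext i; fin_cases i <;> simp }
    (by intro v; ext i; fin_cases i <;> simp)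

/-- The symmetry `U : λ, μ, ν ↦ ν^□, μ, λ^□` (complements in the rectangle of height `3` and
length `ν₁`):
`(λ₁, λ₂ | μ₁, μ₂ | ν₁, ν₂) ↦ (ν₁ - ν₃, ν₁ - ν₂ | μ₁, μ₂ | ν₁, ν₁ - λ₂)`. -/
def symU : (Fin 6 → ℤ) ≃ₗ[ℤ] (Fin 6 → ℤ) :=
  LinearEquiv.ofInvolutive
    { toFun := fun v => ![v 4 - nu3 v, v 4 - v 5, v 2, v 3, v 4, v 4 - v 1]
      map_add' := by intro v w; ext i; fin_cases i <;> simp [nu3] <;> ring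
      map_smul' := by intro a v; ext i; fin_cases i <;> simp [nu3] <;> ring }
    (by intro v; ext i; fin_cases i <;> simp [nu3] <;> ring)

/-- The symmetry `T : λ, μ, ν ↦ λ^□, μ^□, ν^□` (complements in the rectangles of height `3` and
lengths `λ₁`, `μ₁`, `λ₁ + μ₁`): `(λ₁, λ₂ | μ₁, μ₂ | ν₁, ν₂) ↦
(λ₁, λ₁ - λ₂ | μ₁, μ₁ - μ₂ | λ₁ + μ₁ - ν₃, λ₁ + μ₁ - ν₂)`. -/
def symT : (Fin 6 → ℤ) ≃ₗ[ℤ] (Fin 6 → ℤ) :=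
  LinearEquiv.ofInvolutive
    { toFun := fun v =>
        ![v 0, v 0 - v 1, v 2, v 2 - v 3, v 0 + v 2 - nu3 v, v 0 + v 2 - v 5]
      map_add' := by intro v w; ext i; fin_cases i <;> simp [nu3] <;> ring
      map_smul' := by intro a v; ext i; fin_cases i <;> simp [nu3] <;> ring }
    (by intro v; ext i; fin_cases i <;> simp [nu3] <;> ring)

/-- The additional symmetry `X : (λ₁, λ₂ | μ₁, μ₂ | ν₁, ν₂) ↦
(λ₁ + μ₁ - ν₂, λ₂ + μ₁ - ν₂ | ν₂, μ₂ | ν₁, μ₁)`. -/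
def symX : (Fin 6 → ℤ) ≃ₗ[ℤ] (Fin 6 → ℤ) :=
  LinearEquiv.ofInvolutive
    { toFun := fun v => ![v 0 + v 2 - v 5, v 1 + v 2 - v 5, v 5, v 3, v 4, v 2]
      map_add' := by intro v w; ext i; fin_cases i <;> simp <;> ring
      map_smul' := by intro a v; ext i; fin_cases i <;> simp <;> ring }
    (by intro v; ext i; fin_cases i <;> simp)

/-- The group generated by the known symmetries: the `S₃` symmetry, generated by `S` and `U`, and
the involution `T`. -/
def knownSymmetries : Subgroup ((Fin 6 → ℤ) ≃ₗ[ℤ] (Fin 6 → ℤ)) :=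
  Subgroup.closure {symS, symU, symT}

/-- The wreath product `S₃ ≀ S₂`: the semidirect product of `S₃ × S₃` by `S₂`, where `S₂` permutes
the two factors. -/
abbrev S3WrS2 : Type :=
  (Fin 2 → Equiv.Perm (Fin 3)) ⋊[mulAutArrow] Equiv.Perm (Fin 2)

/-! The minimal generators of the rays of the chamber complex of `C`. -/

def rayB : Fin 6 → ℤ := ![2, 1, 2, 1, 3, 2]
def rayC : Fin 6 → ℤ := ![1, 1, 1, 1, 2, 1]
def rayF : Fin 6 → ℤ := ![1, 0, 1, 0, 1, 1]
def rayD1 : Fin 6 → ℤ := ![1, 1, 1, 0, 1, 1]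
def rayE1 : Fin 6 → ℤ := ![1, 1, 0, 0, 1, 1]
def rayG1 : Fin 6 → ℤ := ![1, 0, 0, 0, 1, 0]
def rayD2 : Fin 6 → ℤ := ![1, 0, 1, 1, 1, 1]
def rayE2 : Fin 6 → ℤ := ![0, 0, 1, 1, 1, 1]
def rayG2 : Fin 6 → ℤ := ![0, 0, 1, 0, 1, 0]

/-- The generators of the 18 chambers `κ₁, …, κ₁₈` of Rassart's chamber complex for `C`. -/
def chamberGens : Fin 18 → Fin 6 → Fin 6 → ℤ :=
  ![![rayB, rayC, rayD1, rayE2, rayD2, rayE1],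
    ![rayB, rayC, rayD1, rayG1, rayD2, rayG2],
    ![rayB, rayC, rayE2, rayG1, rayE1, rayG2],
    ![rayB, rayF, rayD1, rayE2, rayD2, rayE1],
    ![rayB, rayF, rayD1, rayG1, rayD2, rayG2],
    ![rayB, rayF, rayE2, rayG1, rayE1, rayG2],
    ![rayB, rayC, rayD1, rayG1, rayD2, rayE1],
    ![rayB, rayC, rayD1, rayE2, rayD2, rayG2],
    ![rayB, rayC, rayD1, rayE2, rayE1, rayG2],
    ![rayB, rayC, rayE2, rayG1, rayD2, rayE1],
    ![rayB, rayC, rayD1, rayG1, rayE1, rayG2],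
    ![rayB, rayC, rayE2, rayG1, rayD2, rayG2],
    ![rayB, rayF, rayD1, rayG1, rayD2, rayE1],
    ![rayB, rayF, rayD1, rayE2, rayD2, rayG2],
    ![rayB, rayF, rayD1, rayG1, rayE1, rayG2],
    ![rayB, rayF, rayE2, rayG1, rayD2, rayG2],
    ![rayB, rayF, rayD1, rayE2, rayE1, rayG2],
    ![rayB, rayF, rayE2, rayG1, rayD2, rayE1]]

/-- The chamber `κ_{i+1}`: the closed convex cone in `ℝ⁶` spanned by its six generators. -/
noncomputable def chamber (i : Fin 18) : PointedCone ℝ (Fin 6 → ℝ) :=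
  PointedCone.hull ℝ (Set.range fun k : Fin 6 => fun m : Fin 6 => (chamberGens i k m : ℝ))

/-- The set of the chambers of the chamber complex. -/
def chambers : Set (PointedCone ℝ (Fin 6 → ℝ)) := Set.range chamber

/-- The extension of a linear automorphism of `ℤ⁶` to a linear map of `ℝ⁶` (same matrix). -/
noncomputable def realExt (F : (Fin 6 → ℤ) ≃ₗ[ℤ] (Fin 6 → ℤ)) :
    (Fin 6 → ℝ) →ₗ[ℝ] (Fin 6 → ℝ) :=
  Matrix.toLin' ((LinearMap.toMatrix' (F : (Fin 6 → ℤ) →ₗ[ℤ] (Fin 6 → ℤ))).map (Int.cast : ℤ → ℝ))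

/-! ### Skew shapes with three rows, counted row by row -/

section
open Finset

/-! A Littlewood–Richardson tableau with two letters and three rows has only zeros in its first row,
and the content leaves one free parameter, the number of zeros in the third row. So `C` counts the
integers between three lower and six upper bounds: it is one plus the minimum of eighteen linear
forms, truncated at zero (`lt_sl3LR_iff`).

The symmetry shows in terms of the eight rays other than `b`. They span `ℤ⁶`, with relations
generated by `c + f = d₁ + e₂ + g₁ = d₂ + e₁ + g₂` (the common value is `b`). On a combination of
rays, the eighteen forms are the sums of one coefficient from each of the three blocks
(`lt_sl3LR_rayComb_iff`). Hence every permutation of the rays respecting the blocks, the two blocks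
of three being interchangeable, extends to a linear symmetry.

Conversely, a symmetry preserves the semigroup `C > 0`, so it permutes its indecomposable elements,
which are the eight rays. It respects the blocks, because a sum of distinct rays has `C > 1` only
when it contains a whole block. As the rays span, nothing else is possible.

A chamber omits one ray of each block, so the action on chambers is the action on the `2 · 3 · 3`
transversals of the blocks. Orders and generation are then finite computations with permutations. -/

theorem mem_diagram3 {a b c : ℕ} (hab : b ≤ a) (hbc : c ≤ b) (i j : ℕ) :
    (i, j) ∈ diagram3 a b c hab hbc ↔ (i = 0 ∧ j < a) ∨ (i = 1 ∧ j < b) ∨ (i = 2 ∧ j < c) := by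
  unfold diagram3
  rw [YoungDiagram.mem_ofRowLens]
  rcases i with _ | _ | _ | i <;> simp

theorem rowLen_diagram3 {a b c : ℕ} (hab : b ≤ a) (hbc : c ≤ b) (i : ℕ) :
    (diagram3 a b c hab hbc).rowLen i =
      if i = 0 then a else if i = 1 then b else if i = 2 then c else 0 := by
  refine eq_of_forall_lt_iff fun j => ?_
  rw [← YoungDiagram.mem_iff_lt_rowLen, mem_diagram3]
  split_ifs <;> simp_all

theorem diagram3_le_iff {a b c a' b' c' : ℕ} (hab : b ≤ a) (hbc : c ≤ b) (hab' : b' ≤ a')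
    (hbc' : c' ≤ b') :
    diagram3 a b c hab hbc ≤ diagram3 a' b' c' hab' hbc' ↔ a ≤ a' ∧ b ≤ b' ∧ c ≤ c' := by
  constructor
  · intro h
    have key : ∀ i, (diagram3 a b c hab hbc).rowLen i ≤ (diagram3 a' b' c' hab' hbc').rowLen i := by
      intro i
      refine le_of_forall_lt fun j hj => ?_
      rw [← YoungDiagram.mem_iff_lt_rowLen] at hj ⊢
      exact h hj
    have h0 := key 0
    have h1 := key 1
    have h2 := key 2
    simp only [rowLen_diagram3] at h0 h1 h2
    exact ⟨by simpa using h0, by simpa using h1, by simpa using h2⟩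
  · rintro ⟨h0, h1, h2⟩ ⟨i, j⟩ h
    change (i, j) ∈ diagram3 _ _ _ _ _ at h
    rw [mem_diagram3] at h ⊢
    omega

theorem mem_skew_diagram3 {l1 l2 n1 n2 n3 : ℕ} (hl : l2 ≤ l1) (hn : n2 ≤ n1) (hn' : n3 ≤ n2)
    (i j : ℕ) :
    (i, j) ∈ (diagram3 n1 n2 n3 hn hn').cells \ (diagram3 l1 l2 0 hl l2.zero_le).cells ↔
      (i = 0 ∧ l1 ≤ j ∧ j < n1) ∨ (i = 1 ∧ l2 ≤ j ∧ j < n2) ∨ (i = 2 ∧ j < n3) := by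
  rw [Finset.mem_sdiff, YoungDiagram.mem_cells, YoungDiagram.mem_cells, mem_diagram3, mem_diagram3]
  omega

/-- Cells of a skew shape with three rows can be counted row by row. -/
theorem card_filter_skew_diagram3 {l1 l2 n1 n2 n3 : ℕ} (hl : l2 ≤ l1) (hn : n2 ≤ n1)
    (hn' : n3 ≤ n2) (P : ℕ × ℕ → Prop) [DecidablePred P] :
    (((diagram3 n1 n2 n3 hn hn').cells \ (diagram3 l1 l2 0 hl l2.zero_le).cells).filter P).card =
      ((Ico l1 n1).filter fun j => P (0, j)).card + ((Ico l2 n2).filter fun j => P (1, j)).card +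
        ((Ico 0 n3).filter fun j => P (2, j)).card := by
  have e : ((diagram3 n1 n2 n3 hn hn').cells \ (diagram3 l1 l2 0 hl l2.zero_le).cells).filter P =
      (((Ico l1 n1).filter fun j => P (0, j)).map (Function.Embedding.sectR 0 ℕ)) ∪
        (((Ico l2 n2).filter fun j => P (1, j)).map (Function.Embedding.sectR 1 ℕ)) ∪
        (((Ico 0 n3).filter fun j => P (2, j)).map (Function.Embedding.sectR 2 ℕ)) := by
    ext ⟨i, j⟩
    rw [mem_filter, mem_skew_diagram3]
    simp only [mem_union, mem_map, mem_filter, mem_Ico, Function.Embedding.sectR_apply,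
      Prod.mk.injEq, Nat.zero_le, true_and]
    constructor
    · rintro ⟨⟨rfl, h⟩ | ⟨rfl, h⟩ | ⟨rfl, h⟩, hP⟩
      · exact Or.inl (Or.inl ⟨j, ⟨h, hP⟩, rfl, rfl⟩)
      · exact Or.inl (Or.inr ⟨j, ⟨h, hP⟩, rfl, rfl⟩)
      · exact Or.inr ⟨j, ⟨h, hP⟩, rfl, rfl⟩
    · rintro ((⟨j, ⟨h, hP⟩, rfl, rfl⟩ | ⟨j, ⟨h, hP⟩, rfl, rfl⟩) | ⟨j, ⟨h, hP⟩, rfl, rfl⟩)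
      · exact ⟨Or.inl ⟨rfl, h⟩, hP⟩
      · exact ⟨Or.inr (Or.inl ⟨rfl, h⟩), hP⟩
      · exact ⟨Or.inr (Or.inr ⟨rfl, h⟩), hP⟩
  rw [e, card_union_of_disjoint, card_union_of_disjoint, card_map, card_map, card_map]
  · rw [disjoint_left]
    rintro ⟨i, j⟩ h h'
    simp only [mem_map, Function.Embedding.sectR_apply, Prod.mk.injEq] at h h'
    obtain ⟨_, _, rfl, _⟩ := h
    obtain ⟨_, _, h, _⟩ := h'
    omega
  · rw [disjoint_left]
    rintro ⟨i, j⟩ h h'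
    simp only [mem_union, mem_map, Function.Embedding.sectR_apply, Prod.mk.injEq] at h h'
    obtain ⟨_, _, h', _⟩ := h'
    rcases h with ⟨_, _, h, _⟩ | ⟨_, _, h, _⟩ <;> omega

theorem card_filter_Ico_eq {a b c d : ℕ} {P : ℕ → Prop} [DecidablePred P]
    (h : ∀ x, a ≤ x → x < b → (P x ↔ c ≤ x ∧ x < d)) :
    ((Ico a b).filter P).card = min b d - max a c := by
  rw [← Nat.card_Ico]
  congr 1
  ext x
  rw [mem_filter, mem_Ico, mem_Ico]
  constructor
  · rintro ⟨⟨h1, h2⟩, h3⟩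
    have := (h x h1 h2).1 h3
    omega
  · intro hx
    exact ⟨by omega, (h x (by omega) (by omega)).2 (by omega)⟩

/-- A monotone sequence of zeros and ones has a threshold. -/
theorem exists_threshold {a b : ℕ} (hab : a ≤ b) (f : ℕ → ℕ)
    (hmono : ∀ j j', j < j' → a ≤ j → j' < b → f j ≤ f j')
    (hle : ∀ j, a ≤ j → j < b → f j ≤ 1) :
    ∃ z, a ≤ z ∧ z ≤ b ∧ ∀ j, a ≤ j → j < b → f j = if j < z then 0 else 1 := by
  induction b, hab using Nat.le_induction with
  | base => exact ⟨a, le_rfl, le_rfl, fun j h h' => by omega⟩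
  | succ b hab ih =>
    obtain ⟨z, h1, h2, h3⟩ := ih (fun j j' h h' h'' => hmono j j' h h' (by omega))
      (fun j h h' => hle j h (by omega))
    rcases Nat.lt_or_ge (f b) 1 with hb | hb
    · refine ⟨b + 1, by omega, le_rfl, fun j hj hj' => ?_⟩
      rw [if_pos hj']
      rcases Nat.lt_or_ge j b with h | h
      · have := hmono j b h hj (by omega)
        omega
      · have : j = b := by omega
        subst this
        omega
    · refine ⟨z, h1, by omega, fun j hj hj' => ?_⟩
      rcases Nat.lt_or_ge j b with h | h
      · exact h3 j hj h
      · have : j = b := by omega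
        subst this
        have := hle j hj hj'
        rw [if_neg (by omega)]
        omega

/-! ### Two-letter tableaux as pairs of thresholds -/

/-- The filling of a three-row shape with letters `0` and `1` whose first row has only letters `0`,
and whose letters `1` start in column `z₁` of the second row and in column `z₂` of the third. -/
def twoLetterFilling (n2 n3 z1 z2 : ℕ) (i j : ℕ) : ℕ :=
  if (i = 1 ∧ z1 ≤ j ∧ j < n2) ∨ (i = 2 ∧ z2 ≤ j ∧ j < n3) then 1 else 0

/-- The conditions for a filling by thresholds to be a Littlewood–Richardson tableau. -/
structure LRThresholds (l1 l2 m1 m2 n1 n2 n3 z1 z2 : ℕ) : Prop where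
  le1 : l1 ≤ n1
  lower : l2 ≤ z1
  upper : z1 ≤ n2
  upper' : z2 ≤ n3
  content0 : (n1 - l1) + (z1 - l2) + z2 = m1
  content1 : (n2 - z1) + (n3 - z2) = m2
  col01 : z1 ≤ l1
  col12 : z2 ≤ l2
  col12' : n3 ≤ z1
  lattice1 : n2 - z1 ≤ n1 - l1
  lattice2 : m2 ≤ n1 - l1 + (z1 - l2)

section
variable {l1 l2 m1 m2 n1 n2 n3 : ℕ} (hl : l2 ≤ l1) (hm : m2 ≤ m1) (hn : n2 ≤ n1) (hn' : n3 ≤ n2)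

theorem twoLetterFilling_eq_zero_iff {z1 z2 i j : ℕ} : twoLetterFilling n2 n3 z1 z2 i j = 0 ↔
    ¬ ((i = 1 ∧ z1 ≤ j ∧ j < n2) ∨ (i = 2 ∧ z2 ≤ j ∧ j < n3)) := by
  unfold twoLetterFilling; split_ifs <;> simp_all

theorem twoLetterFilling_eq_one_iff {z1 z2 i j : ℕ} : twoLetterFilling n2 n3 z1 z2 i j = 1 ↔
    (i = 1 ∧ z1 ≤ j ∧ j < n2) ∨ (i = 2 ∧ z2 ≤ j ∧ j < n3) := by
  unfold twoLetterFilling; split_ifs <;> simp_all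

theorem card_twoLetterFilling_eq_zero {z1 z2 : ℕ} (h1 : l2 ≤ z1) (h2 : z1 ≤ n2) (h3 : z2 ≤ n3)
    (i j : ℕ) :
    (((diagram3 n1 n2 n3 hn hn').cells \ (diagram3 l1 l2 0 hl l2.zero_le).cells).filter
      (fun c => (c.1 < i ∨ c.1 = i ∧ j ≤ c.2) ∧ twoLetterFilling n2 n3 z1 z2 c.1 c.2 = 0)).card =
    (if i = 0 then n1 - max l1 j else n1 - l1) +
      (if i = 0 then 0 else if i = 1 then z1 - max l2 j else z1 - l2) +
      (if i < 2 then 0 else if i = 2 then z2 - j else z2) := by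
  rw [card_filter_skew_diagram3]
  simp only [twoLetterFilling_eq_zero_iff, zero_ne_one,
    OfNat.zero_ne_ofNat, OfNat.one_ne_ofNat, OfNat.ofNat_ne_one, false_and, true_and, or_false,
    false_or, and_true, not_false_eq_true]
  congr 1
  · congr 1
    · rw [card_filter_Ico_eq (c := if i = 0 then j else 0) (d := n1)]
      · split_ifs <;> omega
      · intro x hx hx'; split_ifs <;> omega
    · rw [card_filter_Ico_eq (c := if i = 1 then j else 0) (d := if i = 0 then 0 else z1)]
      · split_ifs <;> omega
      · intro x hx hx'; split_ifs <;> omega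
  · rw [card_filter_Ico_eq (c := if i = 2 then j else 0) (d := if i < 2 then 0 else z2)]
    · split_ifs <;> omega
    · intro x hx hx'; split_ifs <;> omega

theorem card_twoLetterFilling_eq_one {z1 z2 : ℕ} (h1 : l2 ≤ z1) (h2 : z1 ≤ n2) (h3 : z2 ≤ n3)
    (i j : ℕ) :
    (((diagram3 n1 n2 n3 hn hn').cells \ (diagram3 l1 l2 0 hl l2.zero_le).cells).filter
      (fun c => (c.1 < i ∨ c.1 = i ∧ j ≤ c.2) ∧ twoLetterFilling n2 n3 z1 z2 c.1 c.2 = 1)).card =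
      (if i = 0 then 0 else if i = 1 then n2 - max z1 j else n2 - z1) +
      (if i < 2 then 0 else if i = 2 then n3 - max z2 j else n3 - z2) := by
  rw [card_filter_skew_diagram3]
  simp only [twoLetterFilling_eq_one_iff, zero_ne_one,
    OfNat.zero_ne_ofNat, OfNat.one_ne_ofNat, OfNat.ofNat_ne_one, false_and, true_and, or_false,
    false_or, and_false]
  rw [card_filter_Ico_eq (a := l1) (c := 0) (d := 0), min_eq_right (Nat.zero_le _), Nat.zero_sub,
    Nat.zero_add]
  · congr 1
    · rw [card_filter_Ico_eq (c := if i = 1 then max z1 j else z1) (d := if i = 0 then 0 else n2)]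
      · split_ifs <;> omega
      · intro x hx hx'; split_ifs <;> omega
    · rw [card_filter_Ico_eq (c := if i = 2 then max z2 j else z2) (d := if i < 2 then 0 else n3)]
      · split_ifs <;> omega
      · intro x hx hx'; split_ifs <;> omega
  · intro x hx hx'; exact ⟨False.elim, fun h => by omega⟩

theorem twoLetterFilling_le_one {z1 z2 : ℕ} (i j : ℕ) : twoLetterFilling n2 n3 z1 z2 i j ≤ 1 := by
  unfold twoLetterFilling; split_ifs <;> omega

/-- The reading of the first three rows covers all the cells. -/
theorem filter_reading_three (E : ℕ → ℕ → ℕ) (k : ℕ) :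
    ((diagram3 n1 n2 n3 hn hn').cells \ (diagram3 l1 l2 0 hl l2.zero_le).cells).filter
      (fun c => (c.1 < 3 ∨ c.1 = 3 ∧ 0 ≤ c.2) ∧ E c.1 c.2 = k) =
    ((diagram3 n1 n2 n3 hn hn').cells \ (diagram3 l1 l2 0 hl l2.zero_le).cells).filter
      (fun c => E c.1 c.2 = k) := by
  refine filter_congr ?_
  rintro ⟨i, j⟩ h
  rw [mem_skew_diagram3] at h
  constructor
  · exact fun h => h.2
  · exact fun h' => ⟨Or.inl (by simp only; omega), h'⟩

/-- The Littlewood–Richardson tableau with given thresholds. -/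
def LRTableau.ofThresholds {z1 z2 : ℕ} (h : LRThresholds l1 l2 m1 m2 n1 n2 n3 z1 z2) :
    LRTableau (diagram3 l1 l2 0 hl l2.zero_le) (diagram3 m1 m2 0 hm m2.zero_le)
      (diagram3 n1 n2 n3 hn hn') where
  entry := twoLetterFilling n2 n3 z1 z2
  le := (diagram3_le_iff _ _ _ _).2 ⟨h.le1, h.lower.trans h.upper, Nat.zero_le _⟩
  zeros := by
    intro i j hij
    rw [mem_skew_diagram3] at hij
    have := h.lower
    unfold twoLetterFilling
    rw [if_neg (by omega)]
  row_weak := by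
    intro i j j' hj h1 h2
    rw [mem_skew_diagram3] at h1 h2
    unfold twoLetterFilling
    split_ifs <;> omega
  col_strict := by
    intro i i' j hi h1 h2
    rw [mem_skew_diagram3] at h1 h2
    obtain ⟨a1, a2, a3, a4, a5, a6, a7, a8, a9, a10, a11⟩ := h
    unfold twoLetterFilling
    split_ifs <;> omega
  content := by
    intro k
    rw [← filter_reading_three, rowLen_diagram3]
    rcases k with _ | _ | k
    · rw [card_twoLetterFilling_eq_zero hl hn hn' h.lower h.upper h.upper']
      simpa using h.content0
    · rw [card_twoLetterFilling_eq_one hl hn hn' h.lower h.upper h.upper']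
      simpa using h.content1
    · rw [filter_eq_empty_iff.2]
      · simp
      · intro c _ hc
        have := twoLetterFilling_le_one (n2 := n2) (n3 := n3) (z1 := z1) (z2 := z2) c.1 c.2
        omega
  lattice := by
    intro i j k
    rcases k with _ | k
    · rw [zero_add, card_twoLetterFilling_eq_zero hl hn hn' h.lower h.upper h.upper',
        card_twoLetterFilling_eq_one hl hn hn' h.lower h.upper h.upper']
      obtain ⟨a1, a2, a3, a4, a5, a6, a7, a8, a9, a10, a11⟩ := h
      split_ifs <;> omega
    · rw [filter_eq_empty_iff.2]
      · simp
      · intro c _ hc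
        have := twoLetterFilling_le_one (n2 := n2) (n3 := n3) (z1 := z1) (z2 := z2) c.1 c.2
        omega

/-- The content excludes letters above `1`, the lattice condition excludes `1` from the first row,
and weakly increasing rows make each other row a run of zeros followed by a run of ones. -/
theorem LRTableau.exists_thresholds
    (t : LRTableau (diagram3 l1 l2 0 hl l2.zero_le) (diagram3 m1 m2 0 hm m2.zero_le)
      (diagram3 n1 n2 n3 hn hn')) :
    ∃ z1 z2, LRThresholds l1 l2 m1 m2 n1 n2 n3 z1 z2 ∧ t.entry = twoLetterFilling n2 n3 z1 z2 := by
  have hle := (diagram3_le_iff _ _ _ _).1 t.le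
  have h01 : ∀ i j, t.entry i j ≤ 1 := by
    intro i j
    by_contra hcon
    have hmem : (i, j) ∈ (diagram3 n1 n2 n3 hn hn').cells \
        (diagram3 l1 l2 0 hl l2.zero_le).cells := by
      by_contra h
      rw [t.zeros i j h] at hcon
      omega
    have hc := t.content (t.entry i j)
    rw [rowLen_diagram3, if_neg (by omega), if_neg (by omega), ite_self, card_eq_zero,
      filter_eq_empty_iff] at hc
    exact hc hmem rfl
  have hrow0 : ∀ j, t.entry 0 j = 0 := by
    intro j
    by_contra hcon
    have hmem : (0, j) ∈ (diagram3 n1 n2 n3 hn hn').cells \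
        (diagram3 l1 l2 0 hl l2.zero_le).cells := by
      by_contra h
      exact hcon (t.zeros 0 j h)
    -- Read the first row up to a supposed `1` in column `j`: no `0` has been read yet, since the
    -- cells further right carry larger or equal letters.
    have hc := t.lattice 0 j 0
    rw [filter_eq_empty_iff (p := fun c : ℕ × ℕ => (c.1 < 0 ∨ c.1 = 0 ∧ j ≤ c.2) ∧
      t.entry c.1 c.2 = 0) |>.2, card_empty, Nat.le_zero, card_eq_zero, filter_eq_empty_iff] at hc
    · have := h01 0 j
      exact hc hmem ⟨Or.inr ⟨rfl, le_rfl⟩, by change t.entry 0 j = 0 + 1; omega⟩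
    · rintro ⟨i, j'⟩ hmem' ⟨h1 | ⟨h1, h2⟩, h3⟩
      · omega
      · simp only at h1 h2 h3
        subst h1
        rcases h2.eq_or_lt with rfl | h2
        · exact hcon h3
        · have := t.row_weak 0 j j' h2 hmem hmem'
          omega
  obtain ⟨z1, h1, h2, h3⟩ := exists_threshold hle.2.1 (t.entry 1)
    (fun j j' h h' h'' => t.row_weak 1 j j' h (by rw [mem_skew_diagram3]; omega)
      (by rw [mem_skew_diagram3]; omega)) (fun j _ _ => h01 1 j)
  obtain ⟨z2, -, h4, h5⟩ := exists_threshold n3.zero_le (t.entry 2)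
    (fun j j' h h' h'' => t.row_weak 2 j j' h (by rw [mem_skew_diagram3]; omega)
      (by rw [mem_skew_diagram3]; omega)) (fun j _ _ => h01 2 j)
  have hE : t.entry = twoLetterFilling n2 n3 z1 z2 := by
    funext i j
    by_cases hmem : (i, j) ∈ (diagram3 n1 n2 n3 hn hn').cells \
        (diagram3 l1 l2 0 hl l2.zero_le).cells
    · rw [mem_skew_diagram3] at hmem
      unfold twoLetterFilling
      rcases hmem with ⟨rfl, h⟩ | ⟨rfl, h⟩ | ⟨rfl, h⟩
      · rw [hrow0, if_neg (by omega)]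
      · rw [h3 j h.1 h.2]
        split_ifs <;> omega
      · rw [h5 j j.zero_le h]
        split_ifs <;> omega
    · rw [t.zeros i j hmem]
      rw [mem_skew_diagram3] at hmem
      unfold twoLetterFilling
      rw [if_neg (by omega)]
  refine ⟨z1, z2, ?_, hE⟩
  have hcol := t.col_strict
  have hcont := t.content
  have hlat := t.lattice
  simp only [hE] at hcol hcont hlat
  have c0 := hcont 0
  have c1 := hcont 1
  rw [← filter_reading_three, card_twoLetterFilling_eq_zero hl hn hn' h1 h2 h4,
    rowLen_diagram3] at c0
  rw [← filter_reading_three, card_twoLetterFilling_eq_one hl hn hn' h1 h2 h4,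
    rowLen_diagram3] at c1
  -- The lattice condition is tightest just after the last `1` of a row is read, in columns `z1` and
  -- `z2`.
  have d1 := hlat 1 z1 0
  have d2 := hlat 2 z2 0
  rw [zero_add, card_twoLetterFilling_eq_zero hl hn hn' h1 h2 h4,
    card_twoLetterFilling_eq_one hl hn hn' h1 h2 h4] at d1 d2
  simp at c0 c1 d1 d2
  have col {i i' j : ℕ} (h : i < i') := hcol i i' j h
  simp only [mem_skew_diagram3, twoLetterFilling] at col
  -- A violated column bound shows in one column: two zeros stacked in column `l1` or `l2`, or two
  -- ones stacked in column `z1`.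
  refine ⟨hle.1, h1, h2, h4, c0, c1, ?_, ?_, ?_, by omega, by omega⟩
  · by_contra hcon
    have := col (i := 0) (i' := 1) (j := l1) (by omega) (by omega) (by omega)
    split_ifs at this <;> omega
  · by_contra hcon
    have := col (i := 1) (i' := 2) (j := l2) (by omega) (by omega) (by omega)
    split_ifs at this <;> omega
  · by_contra hcon
    have := col (i := 1) (i' := 2) (j := z1) (by omega) (by omega) (by omega)
    split_ifs at this <;> omega

/-- A Littlewood–Richardson coefficient with at most two, two and three rows counts the integers in
an interval. -/
theorem lrCoeff_diagram3 (hsum : l1 + l2 + m1 + m2 = n1 + n2 + n3) {lo hi : ℤ}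
    (hlohi : ∀ r : ℤ, (lo ≤ r ∧ r ≤ hi) ↔ 0 ≤ r ∧ (n3 : ℤ) - m2 ≤ r ∧ (m1 : ℤ) + l2 - n1 ≤ r ∧
      r ≤ l2 ∧ r ≤ n3 ∧ r ≤ (m1 : ℤ) + l1 - n1 ∧ r ≤ (n2 : ℤ) - m2 ∧ r ≤ (l2 : ℤ) + m1 - n2 ∧
      r ≤ (m1 : ℤ) - m2) :
    lrCoeff (diagram3 l1 l2 0 hl l2.zero_le) (diagram3 m1 m2 0 hm m2.zero_le)
      (diagram3 n1 n2 n3 hn hn') = (hi + 1 - lo).toNat := by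
  -- The parameter `r` is the number of zeros in the third row; counting all zeros then forces the
  -- threshold of the second row.
  have good : ∀ r ∈ Icc lo hi, LRThresholds l1 l2 m1 m2 n1 n2 n3
      ((m1 : ℤ) + l1 + l2 - n1 - r).toNat r.toNat := by
    intro r hr
    rw [mem_Icc, hlohi] at hr
    constructor <;> omega
  rw [← Int.card_Icc, ← Fintype.card_coe, ← Nat.card_eq_fintype_card]
  refine (Nat.card_congr (Equiv.ofBijective
    (fun r : Icc lo hi => LRTableau.ofThresholds hl hm hn hn' (good r.1 r.2)) ⟨?_, ?_⟩)).symm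
  · intro r r' h
    have h' : twoLetterFilling _ _ _ _ = twoLetterFilling _ _ _ _ := congrArg LRTableau.entry h
    have g := good _ r.2
    have g' := good _ r'.2
    have a := (hlohi r).1 (mem_Icc.1 r.2)
    have a' := (hlohi r').1 (mem_Icc.1 r'.2)
    -- Two fillings with different parameters differ in the third row at the column of the smaller
    -- one.
    have e := congrFun (congrFun h' 2) (min (r : ℤ) r').toNat
    have u := g.upper'
    have u' := g'.upper'
    unfold twoLetterFilling at e
    apply Subtype.ext
    split_ifs at e <;> omega
  · intro t
    obtain ⟨z1, z2, h, ht⟩ := t.exists_thresholds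
    obtain ⟨a1, a2, a3, a4, a5, a6, a7, a8, a9, a10, a11⟩ := h
    refine ⟨⟨z2, ?_⟩, ?_⟩
    · rw [mem_Icc, hlohi]
      omega
    · apply LRTableau.ext
      change twoLetterFilling _ _ _ _ = t.entry
      rw [ht]
      congr 1
      simp only
      omega
end

/-! ### The function `C` as a minimum of eighteen linear forms -/

/-- Comparing with an arbitrary `n` turns maxima, minima and truncation into a conjunction of linear
inequalities. -/
theorem lt_sl3LR_iff (n : ℕ) (v : Fin 6 → ℤ) : n < sl3LR v ↔
    ∀ l ∈ ([0, nu3 v - v 3, v 2 + v 1 - v 4] : List ℤ),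
      ∀ u ∈ ([v 1, nu3 v, v 2 + v 0 - v 4, v 5 - v 3, v 1 + v 2 - v 5, v 2 - v 3] : List ℤ),
        n ≤ u - l := by
  have hnu : nu3 v = v 0 + v 1 + v 2 + v 3 - v 4 - v 5 := rfl
  simp only [List.forall_mem_cons, List.not_mem_nil, false_imp_iff, implies_true, and_true]
  unfold sl3LR
  split_ifs with h
  · rw [lrCoeff_diagram3 (lo := max 0 (max (nu3 v - v 3) (v 2 + v 1 - v 4)))
      (hi := min (v 1) (min (nu3 v) (min (v 2 + v 0 - v 4) (min (v 5 - v 3)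
        (min (v 1 + v 2 - v 5) (v 2 - v 3))))))]
    · rw [Int.lt_toNat, lt_sub_iff_add_lt, Int.lt_add_one_iff, ← le_sub_iff_add_le']
      simp only [le_sub_iff_add_le, le_min_iff]
      constructor <;> intro h' <;> and_intros <;> omega
    · omega
    · intro r
      simp only [max_le_iff, le_min_iff]
      constructor <;> intro h' <;> and_intros <;> omega
  -- Outside the domain no case is lost: the differences of upper and lower bounds include the
  -- partition inequalities.
  · refine ⟨fun h' => by omega, fun h' => (h ?_).elim⟩
    and_intros <;> omega

end

/-! ### The block group as permutations of eight rays -/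

/-- The group `S₂ × (S₃ ≀ S₂)`. -/
abbrev BlockGroup : Type := Equiv.Perm (Fin 2) × S3WrS2

/-- The index set of the rays different from `b`: a block of two and two blocks of three rays. -/
abbrev RayIndex : Type := Fin 2 ⊕ Fin 2 × Fin 3

namespace BlockGroup

/-- The permutation of the rays given by an element of `S₂ × (S₃ ≀ S₂)`. -/
def toPerm : BlockGroup →* Equiv.Perm RayIndex where
  toFun g :=
    { toFun := Sum.map g.1 fun x => (g.2.right x.1, g.2.left (g.2.right x.1) x.2)
      invFun := Sum.map g.1.symm fun x => (g.2.right.symm x.1, (g.2.left x.1).symm x.2)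
      left_inv := by rintro (a | ⟨i, j⟩) <;> simp
      right_inv := by rintro (a | ⟨i, j⟩) <;> simp }
  map_one' := by ext (a | ⟨i, j⟩) <;> rfl
  map_mul' g h := by
    refine Equiv.ext ?_
    rintro (a | ⟨i, j⟩)
    · rfl
    · simp only [Equiv.coe_fn_mk, Equiv.Perm.mul_apply, Sum.map_inr, Prod.snd_mul,
        SemidirectProduct.mul_right, SemidirectProduct.mul_left, Pi.mul_apply, Sum.inr.injEq,
        Prod.mk.injEq, true_and]
      congr 1
      change h.2.left (g.2.right.symm (g.2.right (h.2.right i))) j = _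
      rw [Equiv.symm_apply_apply]

@[simp]
theorem toPerm_inl (g : BlockGroup) (a : Fin 2) : toPerm g (.inl a) = .inl (g.1 a) := rfl

@[simp]
theorem toPerm_inr (g : BlockGroup) (x : Fin 2 × Fin 3) :
    toPerm g (.inr x) = .inr (g.2.right x.1, g.2.left (g.2.right x.1) x.2) := rfl

theorem toPerm_injective : Function.Injective toPerm := by
  intro g h e
  have e1 : ∀ k, toPerm g k = toPerm h k := fun k => by rw [e]
  have hr : g.2.right = h.2.right := by
    ext i : 1
    have := e1 (.inr (i, 0))
    simp only [toPerm_inr, Sum.inr.injEq, Prod.mk.injEq] at this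
    exact this.1
  refine Prod.ext ?_ (SemidirectProduct.ext ?_ hr)
  · ext a : 1
    simpa using e1 (.inl a)
  · funext i
    ext j : 1
    have := e1 (.inr (g.2.right.symm i, j))
    simp only [toPerm_inr, Sum.inr.injEq, Prod.mk.injEq] at this
    rw [← hr] at this
    simpa using this.2

end BlockGroup

/-! ### Relations between the rays, and `C` in ray coefficients -/

/-- The generators of the rays different from `b`. -/
def ray : RayIndex → Fin 6 → ℤ :=
  Sum.elim ![rayC, rayF] fun x => ![![rayD1, rayE2, rayG1], ![rayD2, rayE1, rayG2]] x.1 x.2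

/-- The linear map sending coefficients to the corresponding combination of the rays. -/
def rayComb : (RayIndex → ℤ) →ₗ[ℤ] Fin 6 → ℤ := Fintype.linearCombination ℤ ray

/-- A linear section of `rayComb`. -/
def rayCoeff : (Fin 6 → ℤ) →ₗ[ℤ] RayIndex → ℤ where
  toFun v := Sum.elim ![0, v 5 - v 3 - v 1] fun x =>
    ![![0, v 3 - nu3 v, v 4 - v 2 - v 1], ![nu3 v, v 1, v 1 + v 2 - v 5]] x.1 x.2
  map_add' v w := by
    ext (a | ⟨i, j⟩)
    · fin_cases a
      · simp
      · simp; ring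
    · fin_cases i <;> fin_cases j <;> simp [nu3] <;> ring
  map_smul' c v := by
    ext (a | ⟨i, j⟩)
    · fin_cases a
      · simp
      · simp; ring
    · fin_cases i <;> fin_cases j <;> simp [nu3] <;> ring

theorem rayComb_apply (w : RayIndex → ℤ) : rayComb w = ∑ k, w k • ray k := rfl

theorem rayComb_single (k : RayIndex) : rayComb (Pi.single k 1) = ray k := by
  rw [rayComb, Fintype.linearCombination_apply_single, one_smul]

theorem rayComb_eq (w : RayIndex → ℤ) : rayComb w =
    ![w (.inl 0) + w (.inl 1) + w (.inr (0, 0)) + w (.inr (0, 2)) + w (.inr (1, 0)) + w (.inr (1, 1)),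
      w (.inl 0) + w (.inr (0, 0)) + w (.inr (1, 1)),
      w (.inl 0) + w (.inl 1) + w (.inr (0, 0)) + w (.inr (0, 1)) + w (.inr (1, 0)) + w (.inr (1, 2)),
      w (.inl 0) + w (.inr (0, 1)) + w (.inr (1, 0)),
      2 * w (.inl 0) + w (.inl 1) + w (.inr (0, 0)) + w (.inr (0, 1)) + w (.inr (0, 2)) +
        w (.inr (1, 0)) + w (.inr (1, 1)) + w (.inr (1, 2)),
      w (.inl 0) + w (.inl 1) + w (.inr (0, 0)) + w (.inr (0, 1)) +
        w (.inr (1, 0)) + w (.inr (1, 1))] := by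
  rw [rayComb_apply, Fintype.sum_sum_type, Fintype.sum_prod_type]
  ext m
  simp only [Fin.sum_univ_two, Fin.sum_univ_three]
  fin_cases m <;>
    simp [ray, rayC, rayF, rayD1, rayE1, rayG1, rayD2, rayE2, rayG2] <;> ring

theorem rayComb_rayCoeff (v : Fin 6 → ℤ) : rayComb (rayCoeff v) = v := by
  rw [rayComb_eq]
  ext m
  fin_cases m <;> simp [rayCoeff, nu3] <;> ring

/-- The relations between the rays: the sums over the three blocks agree. -/
theorem rayComb_eq_zero_iff (u : RayIndex → ℤ) : rayComb u = 0 ↔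
    (∀ a a', u (.inl a) = u (.inl a')) ∧ (∀ i j j', u (.inr (i, j)) = u (.inr (i, j'))) ∧
      u (.inl 0) + ∑ i, u (.inr (i, 0)) = 0 := by
  rw [rayComb_eq, funext_iff]
  simp only [Fin.forall_fin_succ, Fin.sum_univ_two, IsEmpty.forall_iff]
  simp
  constructor <;> intro h <;> and_intros <;> omega

/-- This is the source of all the symmetries: the conditions run over all transversals of the three
blocks. They do not depend on the choice of `w`, since relations are constant on blocks with
constants summing to zero. -/
theorem lt_sl3LR_rayComb_iff (n : ℕ) (w : RayIndex → ℤ) : n < sl3LR (rayComb w) ↔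
    ∀ (a : Fin 2) (h : Fin 2 → Fin 3), (n : ℤ) ≤ w (.inl a) + ∑ i, w (.inr (i, h i)) := by
  have e : (∀ (a : Fin 2) (h : Fin 2 → Fin 3), (n : ℤ) ≤ w (.inl a) + ∑ i, w (.inr (i, h i))) ↔
      ∀ (a : Fin 2) (j j' : Fin 3), (n : ℤ) ≤ w (.inl a) + (w (.inr (0, j)) + w (.inr (1, j'))) := by
    constructor
    · intro H a j j'
      simpa using H a ![j, j']
    · intro H a h
      simpa using H a (h 0) (h 1)
  rw [e, lt_sl3LR_iff, rayComb_eq]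
  simp only [List.forall_mem_cons, List.not_mem_nil, implies_true, and_true,
    Fin.forall_fin_succ, IsEmpty.forall_iff, nu3]
  simp
  constructor <;> intro h <;> and_intros <;> omega

/-! ### The block group acts by linear symmetries -/

namespace BlockGroup

theorem rayComb_comp_toPerm_symm_eq_zero (g : BlockGroup) {u : RayIndex → ℤ} (hu : rayComb u = 0) :
    rayComb (u ∘ (toPerm g).symm) = 0 := by
  rw [rayComb_eq_zero_iff] at hu ⊢
  obtain ⟨h1, h2, h3⟩ := hu
  refine ⟨fun a a' => h1 _ _, fun i j j' => h2 _ _ _, ?_⟩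
  rw [← h3]
  refine congrArg₂ _ (h1 _ _) ?_
  exact (Finset.sum_congr rfl fun i _ => h2 (g.2.right.symm i) _ 0).trans
    (Equiv.sum_comp g.2.right.symm fun i => u (.inr (i, 0)))

theorem rayComb_rayCoeff_comp_toPerm_symm (g : BlockGroup) (w : RayIndex → ℤ) :
    rayComb (rayCoeff (rayComb w) ∘ (toPerm g).symm) = rayComb (w ∘ (toPerm g).symm) := by
  have h : rayComb (rayCoeff (rayComb w) - w) = 0 := by
    rw [map_sub, rayComb_rayCoeff, sub_self]
  exact sub_eq_zero.1 ((map_sub rayComb _ _).symm.trans (rayComb_comp_toPerm_symm_eq_zero g h))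

/-- The endomorphism of `ℤ⁶` permuting the rays. -/
def toEnd : BlockGroup →* Module.End ℤ (Fin 6 → ℤ) where
  toFun g := rayComb ∘ₗ LinearMap.funLeft ℤ ℤ (toPerm g).symm ∘ₗ rayCoeff
  map_one' := LinearMap.ext rayComb_rayCoeff
  map_mul' g h := by
    refine LinearMap.ext fun v => ?_
    change rayComb (rayCoeff v ∘ (toPerm (g * h)).symm) =
      rayComb (rayCoeff (rayComb (rayCoeff v ∘ (toPerm h).symm)) ∘ (toPerm g).symm)
    rw [rayComb_rayCoeff_comp_toPerm_symm, map_mul]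
    rfl

/-- The linear automorphism of `ℤ⁶` permuting the rays. -/
def toLinearEquiv : BlockGroup →* ((Fin 6 → ℤ) ≃ₗ[ℤ] (Fin 6 → ℤ)) :=
  (LinearMap.GeneralLinearGroup.generalLinearEquiv ℤ (Fin 6 → ℤ)).toMonoidHom.comp
    (MonoidHom.toHomUnits toEnd)

theorem toLinearEquiv_rayComb (g : BlockGroup) (w : RayIndex → ℤ) :
    toLinearEquiv g (rayComb w) = rayComb (w ∘ (toPerm g).symm) :=
  rayComb_rayCoeff_comp_toPerm_symm g w

theorem toLinearEquiv_ray (g : BlockGroup) (k : RayIndex) :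
    toLinearEquiv g (ray k) = ray (toPerm g k) := by
  rw [← rayComb_single, toLinearEquiv_rayComb, ← rayComb_single]
  congr 1
  funext l
  simp [Pi.single_apply, Equiv.symm_apply_eq]

theorem _root_.ray_injective : Function.Injective ray := by
  decide

theorem toLinearEquiv_injective : Function.Injective toLinearEquiv := by
  intro g h e
  refine toPerm_injective (Equiv.ext fun k => ray_injective ?_)
  rw [← toLinearEquiv_ray, e, toLinearEquiv_ray]

theorem le_sl3LR_toLinearEquiv (g : BlockGroup) (v : Fin 6 → ℤ) :
    sl3LR v ≤ sl3LR (toLinearEquiv g v) := by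
  rw [← rayComb_rayCoeff v, toLinearEquiv_rayComb]
  refine le_of_forall_lt fun n hn => ?_
  rw [lt_sl3LR_rayComb_iff] at hn ⊢
  intro a h
  refine (hn (g.1.symm a) (fun i => (g.2.left (g.2.right i)).symm (h (g.2.right i)))).trans_eq
    (congrArg₂ _ rfl (Eq.symm ?_))
  refine (Equiv.sum_comp g.2.right fun i =>
    (rayCoeff v ∘ (toPerm g).symm) (.inr (i, h i))).symm.trans (Finset.sum_congr rfl fun i _ => ?_)
  change rayCoeff v (.inr (g.2.right.symm (g.2.right i), _)) = _
  rw [Equiv.symm_apply_apply]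

theorem toLinearEquiv_mem (g : BlockGroup) : toLinearEquiv g ∈ lrSymmetries := by
  funext v
  refine le_antisymm ?_ (le_sl3LR_toLinearEquiv g v)
  -- The reverse inequality is the same one for the inverse.
  have h := le_sl3LR_toLinearEquiv g⁻¹ (toLinearEquiv g v)
  rwa [map_inv, show (toLinearEquiv g)⁻¹ (toLinearEquiv g v) = v from
    (toLinearEquiv g).symm_apply_apply v] at h

end BlockGroup

/-! ### Every symmetry permutes the rays and respects the blocks -/

/-- The indecomposable elements of the semigroup on which `C` is positive. -/
structure IsIndecomposable (v : Fin 6 → ℤ) : Prop where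
  pos : 0 < sl3LR v
  ne_zero : v ≠ 0
  eq_zero_or : ∀ x y, 0 < sl3LR x → 0 < sl3LR y → x + y = v → x = 0 ∨ y = 0

theorem sl3LR_apply_of_mem {F : (Fin 6 → ℤ) ≃ₗ[ℤ] (Fin 6 → ℤ)} (hF : F ∈ lrSymmetries)
    (v : Fin 6 → ℤ) : sl3LR (F v) = sl3LR v :=
  congrFun hF v

theorem IsIndecomposable.map {F : (Fin 6 → ℤ) ≃ₗ[ℤ] (Fin 6 → ℤ)} (hF : F ∈ lrSymmetries)
    {v : Fin 6 → ℤ} (hv : IsIndecomposable v) : IsIndecomposable (F v) where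
  pos := by rw [sl3LR_apply_of_mem hF]; exact hv.pos
  ne_zero := by simpa using hv.ne_zero
  eq_zero_or x y hx hy hxy := by
    have hx' : 0 < sl3LR (F.symm x) := by rwa [← sl3LR_apply_of_mem hF, F.apply_symm_apply]
    have hy' : 0 < sl3LR (F.symm y) := by rwa [← sl3LR_apply_of_mem hF, F.apply_symm_apply]
    have := hv.eq_zero_or _ _ hx' hy' (by rw [← map_add, hxy, F.symm_apply_apply])
    simpa using this

theorem sl3LR_rayComb_pos {w : RayIndex → ℤ} (hw : 0 ≤ w) : 0 < sl3LR (rayComb w) := by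
  rw [lt_sl3LR_rayComb_iff]
  intro a h
  have := Finset.sum_nonneg fun (i : Fin 2) (_ : i ∈ Finset.univ) => hw (.inr (i, h i))
  have := hw (.inl a)
  simp only [Pi.zero_apply] at *
  push_cast
  omega

/-- Subtract from each block of three its minimum and add both minima to the block of two. The
relations allow this, and the least new coefficient there is the minimal transversal sum,
nonnegative by positivity. -/
theorem exists_nonneg_rayComb_eq {v : Fin 6 → ℤ} (hv : 0 < sl3LR v) :
    ∃ w : RayIndex → ℤ, 0 ≤ w ∧ rayComb w = v := by
  obtain ⟨w, rfl⟩ : ∃ w, rayComb w = v := ⟨_, rayComb_rayCoeff v⟩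
  rw [lt_sl3LR_rayComb_iff] at hv
  obtain ⟨a, ha⟩ := Finite.exists_min fun a => w (.inl a)
  have hj : ∀ i, ∃ j, ∀ j', w (.inr (i, j)) ≤ w (.inr (i, j')) :=
    fun i => Finite.exists_min fun j => w (.inr (i, j))
  choose h hh using hj
  have key := hv a h
  rw [Fin.sum_univ_two] at key
  set p := w (.inr (0, h 0)) with hp
  set q := w (.inr (1, h 1)) with hq
  refine ⟨w + Sum.elim (fun _ => p + q) fun x => ![-p, -q] x.1, ?_, ?_⟩
  · rintro (b | ⟨i, j⟩)
    · have := ha b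
      simp only [Pi.zero_apply, Pi.add_apply, Sum.elim_inl]
      omega
    · have := hh i j
      fin_cases i <;> simp at this ⊢ <;> omega
  · rw [map_add, add_eq_left, rayComb_eq_zero_iff]
    refine ⟨fun _ _ => rfl, fun _ _ _ => rfl, ?_⟩
    rw [Fin.sum_univ_two]
    simp
    ring

theorem isIndecomposable_ray (k : RayIndex) : IsIndecomposable (ray k) where
  pos := by
    rw [← rayComb_single]
    exact sl3LR_rayComb_pos (Pi.single_nonneg.2 zero_le_one)
  ne_zero := by revert k; decide
  eq_zero_or x y hx hy hxy := by
    obtain ⟨w, hw, rfl⟩ := exists_nonneg_rayComb_eq hx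
    obtain ⟨w', hw', rfl⟩ := exists_nonneg_rayComb_eq hy
    rw [← rayComb_single, ← map_add, ← sub_eq_zero, ← map_sub, rayComb_eq_zero_iff] at hxy
    -- On a transversal avoiding `k`, the relation `w + w' - e_k` has nonnegative entries with sum
    -- zero. They vanish, and being the block constants they force `w + w' = e_k`.
    obtain ⟨a, h, ha, hh⟩ := (by decide : ∀ k : RayIndex, ∃ (a : Fin 2) (h : Fin 2 → Fin 3),
      k ≠ .inl a ∧ ∀ i, k ≠ .inr (i, h i)) k
    obtain ⟨h1, h2, h3⟩ := hxy
    have hs : ∀ l, w l + w' l = (Pi.single k 1 : RayIndex → ℤ) l := by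
      rw [h1 0 a, Finset.sum_congr rfl fun i _ => h2 i 0 (h i), Fin.sum_univ_two] at h3
      simp only [Pi.sub_apply, Pi.add_apply, Pi.single_eq_of_ne ha.symm,
        Pi.single_eq_of_ne (hh _).symm, sub_zero] at h1 h2 h3
      have nn : ∀ l, 0 ≤ w l + w' l := fun l => add_nonneg (hw l) (hw' l)
      have n1 := nn (.inl a)
      have n2 := nn (.inr (0, h 0))
      have n3 := nn (.inr (1, h 1))
      rintro (b | ⟨i, j⟩)
      · have := h1 b a
        rw [Pi.single_eq_of_ne ha.symm] at this
        omega
      · have := h2 i j (h i)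
        rw [Pi.single_eq_of_ne (hh _).symm] at this
        fin_cases i <;> simp at this ⊢ <;> omega
    have hz : ∀ l, l ≠ k → w l = 0 ∧ w' l = 0 := by
      intro l hl
      have := hs l
      rw [Pi.single_eq_of_ne hl] at this
      have := hw l
      have := hw' l
      simp only [Pi.zero_apply] at *
      omega
    have hk1 := hs k
    rw [Pi.single_eq_same] at hk1
    have b1 := hw k
    have b2 := hw' k
    simp only [Pi.zero_apply] at b1 b2
    rcases (by omega : w k = 0 ∨ w' k = 0) with h0 | h0
    · left
      rw [show w = 0 from funext fun l => (eq_or_ne l k).elim (fun e => e ▸ h0) fun e => (hz l e).1,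
        map_zero]
    · right
      rw [show w' = 0 from funext fun l => (eq_or_ne l k).elim (fun e => e ▸ h0)
        fun e => (hz l e).2, map_zero]

theorem IsIndecomposable.exists_ray_eq {v : Fin 6 → ℤ} (hv : IsIndecomposable v) :
    ∃ k, ray k = v := by
  obtain ⟨w, hw, rfl⟩ := exists_nonneg_rayComb_eq hv.pos
  have hk : ∃ k, w k ≠ 0 := by
    by_contra! h
    exact hv.ne_zero (by rw [show w = 0 from funext h, map_zero])
  obtain ⟨k, hk⟩ := hk
  have hwk : 0 ≤ w - Pi.single k 1 := by
    intro l
    have := hw l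
    rcases eq_or_ne l k with rfl | h
    · simp only [Pi.zero_apply, Pi.sub_apply, Pi.single_eq_same] at *
      omega
    · simpa [h] using this
  have := hv.eq_zero_or (ray k) (rayComb (w - Pi.single k 1)) (isIndecomposable_ray k).pos
    (sl3LR_rayComb_pos hwk) (by rw [map_sub, rayComb_single]; abel)
  rcases this with h | h
  · exact ((isIndecomposable_ray k).ne_zero h).elim
  · rw [map_sub, rayComb_single, sub_eq_zero] at h
    exact ⟨k, h.symm⟩

theorem one_lt_sl3LR_rayC_add_rayF : 1 < sl3LR (ray (.inl 0) + ray (.inl 1)) := by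
  rw [← rayComb_single, ← rayComb_single, ← map_add]
  refine (lt_sl3LR_rayComb_iff 1 _).2 ?_
  decide

theorem one_lt_sl3LR_sum_block (i : Fin 2) :
    1 < sl3LR (ray (.inr (i, 0)) + ray (.inr (i, 1)) + ray (.inr (i, 2))) := by
  simp only [← rayComb_single, ← map_add]
  refine (lt_sl3LR_rayComb_iff 1 _).2 ?_
  revert i
  decide

/-- Two rays meet every transversal only if they fill the block of two. -/
theorem isLeft_of_one_lt_sl3LR {j k : RayIndex} (hjk : j ≠ k) (h : 1 < sl3LR (ray j + ray k)) :
    j.isLeft := by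
  rw [← rayComb_single, ← rayComb_single, ← map_add] at h
  have := (lt_sl3LR_rayComb_iff 1 _).1 h
  clear h
  revert j k
  decide +kernel

theorem fst_eq_of_one_lt_sl3LR {x y z : Fin 2 × Fin 3} (hxy : x ≠ y) (hxz : x ≠ z) (hyz : y ≠ z)
    (h : 1 < sl3LR (ray (.inr x) + ray (.inr y) + ray (.inr z))) : x.1 = y.1 ∧ x.1 = z.1 := by
  simp only [← rayComb_single, ← map_add] at h
  by_contra hcon
  -- Three distinct rays that do not fill a block of three miss some transversal, on which the
  -- coefficient sum is zero.
  obtain ⟨f, hf⟩ := (by decide : ∀ x y z : Fin 2 × Fin 3, x ≠ y → x ≠ z → y ≠ z →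
    ¬ (x.1 = y.1 ∧ x.1 = z.1) → ∃ f : Fin 2 → Fin 3,
      ∀ i, (i, f i) ≠ x ∧ (i, f i) ≠ y ∧ (i, f i) ≠ z) x y z hxy hxz hyz hcon
  have := (lt_sl3LR_rayComb_iff 1 _).1 h 0 f
  simp [hf] at this

theorem linearEquiv_ext_ray {F G : (Fin 6 → ℤ) ≃ₗ[ℤ] (Fin 6 → ℤ)}
    (h : ∀ k, F (ray k) = G (ray k)) : F = G := by
  refine LinearEquiv.ext fun v => ?_
  rw [← rayComb_rayCoeff v, rayComb_apply, map_sum, map_sum]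
  refine Finset.sum_congr rfl fun k _ => ?_
  rw [map_smul, map_smul, h]

theorem exists_equiv_ray_eq {F : (Fin 6 → ℤ) ≃ₗ[ℤ] (Fin 6 → ℤ)} (hF : F ∈ lrSymmetries) :
    ∃ π : Equiv.Perm RayIndex, ∀ k, F (ray k) = ray (π k) := by
  choose π hπ using fun k => ((isIndecomposable_ray k).map hF).exists_ray_eq
  have inj : Function.Injective π := by
    intro k l h
    have := hπ k
    rw [h, hπ l] at this
    exact (ray_injective (F.injective this)).symm
  exact ⟨Equiv.ofBijective π (Finite.injective_iff_bijective.1 inj), fun k => (hπ k).symm⟩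

namespace BlockGroup

theorem exists_block_maps {π : Equiv.Perm RayIndex} (h1 : ∀ a, (π (.inl a)).isLeft) :
    ∃ e : Fin 2 → Fin 2, Function.Injective e ∧ (∀ a, π (.inl a) = .inl (e a)) ∧
    ∃ q : Fin 2 × Fin 3 → Fin 2 × Fin 3, Function.Injective q ∧ ∀ x, π (.inr x) = .inr (q x) := by
  choose e he using fun a => Sum.isLeft_iff.1 (h1 a)
  have einj : Function.Injective e := by
    intro a b h
    have := he a
    rw [h, ← he b] at this
    exact Sum.inl_injective (π.injective this)
  have hr : ∀ x, ∃ y, π (.inr x) = .inr y := by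
    intro x
    rcases hx : π (.inr x) with a | y
    · obtain ⟨b, rfl⟩ := Finite.surjective_of_injective einj a
      rw [← he b] at hx
      exact (Sum.inr_ne_inl (π.injective hx)).elim
    · exact ⟨y, rfl⟩
  choose q hq using hr
  refine ⟨e, einj, he, q, fun x y h => ?_, hq⟩
  have := hq x
  rw [h, ← hq y] at this
  exact Sum.inr_injective (π.injective this)

/-- Permutations of the rays which preserve the block structure come from `S₂ × (S₃ ≀ S₂)`. -/
theorem exists_toPerm_eq {π : Equiv.Perm RayIndex} (h1 : ∀ a, (π (.inl a)).isLeft)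
    (h2 : ∀ i j j' x y, π (.inr (i, j)) = .inr x → π (.inr (i, j')) = .inr y → x.1 = y.1) :
    ∃ g, toPerm g = π := by
  obtain ⟨e, einj, he, q, qinj, hq⟩ := exists_block_maps h1
  have esurj := Finite.surjective_of_injective einj
  have qsurj := Finite.surjective_of_injective qinj
  have qfst : ∀ i j, (q (i, j)).1 = (q (i, 0)).1 := fun i j => h2 i j 0 _ _ (hq _) (hq _)
  have tsurj : Function.Surjective fun i => (q (i, 0)).1 := by
    intro i
    obtain ⟨⟨i', j⟩, h⟩ := qsurj (i, 0)
    exact ⟨i', by simp only [← qfst i' j, h]⟩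
  have tinj := Finite.injective_iff_surjective.2 tsurj
  let τ : Equiv.Perm (Fin 2) := Equiv.ofBijective _ ⟨tinj, tsurj⟩
  have hτ : ∀ i, τ i = (q (i, 0)).1 := fun _ => rfl
  have finj : ∀ i, Function.Injective fun j => (q (τ.symm i, j)).2 := by
    intro i j j' h
    have := qinj (Prod.ext ((qfst _ _).trans (qfst _ _).symm) h)
    exact (Prod.mk.inj this).2
  let f : Fin 2 → Equiv.Perm (Fin 3) := fun i =>
    Equiv.ofBijective _ (Finite.injective_iff_bijective.1 (finj i))
  have hf : ∀ i j, f i j = (q (τ.symm i, j)).2 := fun _ _ => rfl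
  refine ⟨(Equiv.ofBijective e ⟨einj, esurj⟩, ⟨f, τ⟩), Equiv.ext ?_⟩
  rintro (a | ⟨i, j⟩)
  · rw [toPerm_inl, he]
    rfl
  · rw [toPerm_inr, hq]
    refine congrArg Sum.inr (Prod.ext ((hτ i).trans (qfst i j).symm) ?_)
    exact (hf _ _).trans (by rw [Equiv.symm_apply_apply])

theorem exists_toLinearEquiv_eq {F : (Fin 6 → ℤ) ≃ₗ[ℤ] (Fin 6 → ℤ)} (hF : F ∈ lrSymmetries) :
    ∃ g, toLinearEquiv g = F := by
  obtain ⟨π, hπ⟩ := exists_equiv_ray_eq hF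
  have h1 : ∀ a, (π (.inl a)).isLeft := by
    have h := one_lt_sl3LR_rayC_add_rayF
    rw [← sl3LR_apply_of_mem hF, map_add, hπ, hπ] at h
    have hne : π (.inl 0) ≠ π (.inl 1) := π.injective.ne (by decide)
    intro a
    fin_cases a
    · exact isLeft_of_one_lt_sl3LR hne h
    · exact isLeft_of_one_lt_sl3LR hne.symm (by rwa [add_comm])
  have h2 : ∀ i j j' x y, π (.inr (i, j)) = .inr x → π (.inr (i, j')) = .inr y → x.1 = y.1 := by
    obtain ⟨-, -, -, q, qinj, hq⟩ := exists_block_maps h1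
    have hq' : ∀ i j, (q (i, 0)).1 = (q (i, j)).1 := by
      intro i
      have h := one_lt_sl3LR_sum_block i
      rw [← sl3LR_apply_of_mem hF, map_add, map_add, hπ, hπ, hπ, hq, hq, hq] at h
      have := fst_eq_of_one_lt_sl3LR (qinj.ne (by simp)) (qinj.ne (by simp)) (qinj.ne (by simp)) h
      intro j
      fin_cases j
      exacts [rfl, this.1, this.2]
    intro i j j' x y hx hy
    rw [hq, Sum.inr.injEq] at hx hy
    rw [← hx, ← hy, ← hq' i j, ← hq' i j']
  obtain ⟨g, rfl⟩ := exists_toPerm_eq h1 h2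
  exact ⟨g, linearEquiv_ext_ray fun k => (toLinearEquiv_ray g k).trans (hπ k).symm⟩

theorem range_toLinearEquiv : toLinearEquiv.range = lrSymmetries := by
  ext F
  constructor
  · rintro ⟨g, rfl⟩
    exact toLinearEquiv_mem g
  · exact exists_toLinearEquiv_eq

theorem mem_lrSymmetries_iff {F : (Fin 6 → ℤ) ≃ₗ[ℤ] (Fin 6 → ℤ)} :
    F ∈ lrSymmetries ↔ ∃ g, toLinearEquiv g = F := by
  rw [← range_toLinearEquiv, MonoidHom.mem_range]

/-- The group of linear symmetries of `C` is `S₂ × (S₃ ≀ S₂)`. -/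
noncomputable def lrSymmetriesEquiv : lrSymmetries ≃* BlockGroup :=
  ((MonoidHom.ofInjective toLinearEquiv_injective).trans
    (MulEquiv.subgroupCongr range_toLinearEquiv)).symm

theorem card_eq : Nat.card BlockGroup = 144 := by
  rw [Nat.card_prod, SemidirectProduct.card, Nat.card_fun]
  simp only [Nat.card_eq_fintype_card, Fintype.card_perm, Fintype.card_fin]
  rfl

end BlockGroup

/-! ### Chambers as transversals of the blocks -/

/-- The inclusion of `ℤ⁶` in `ℝ⁶`. -/
def intVec (v : Fin 6 → ℤ) : Fin 6 → ℝ := fun m => v m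

theorem realExt_intVec (F : (Fin 6 → ℤ) ≃ₗ[ℤ] (Fin 6 → ℤ)) (v : Fin 6 → ℤ) :
    realExt F (intVec v) = intVec (F v) := by
  rw [realExt, Matrix.toLin'_apply]
  funext m
  refine (RingHom.map_mulVec (Int.castRingHom ℝ) (LinearMap.toMatrix' F.toLinearMap) v m).symm.trans
    ?_
  rw [LinearMap.toMatrix'_mulVec]
  rfl

/-- The generators of the chamber in a given position: `b`, and the rays of the three blocks except
for one ray in each of them. -/
def chamberRays (p : Fin 2 × (Fin 2 → Fin 3)) : Finset (Fin 6 → ℤ) :=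
  insert rayB ((Finset.univ.filter fun k : RayIndex =>
    k ≠ .inl p.1 ∧ ∀ i, k ≠ .inr (i, p.2 i)).image ray)

/-- The chamber for which a given ray is left out in each of the three blocks. -/
noncomputable def blockChamber (p : Fin 2 × (Fin 2 → Fin 3)) : PointedCone ℝ (Fin 6 → ℝ) :=
  PointedCone.hull ℝ (intVec '' chamberRays p)

theorem map_realExt_blockChamber {F : (Fin 6 → ℤ) ≃ₗ[ℤ] (Fin 6 → ℤ)}
    {p q : Fin 2 × (Fin 2 → Fin 3)} (h : (chamberRays p).image F = chamberRays q) :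
    PointedCone.map (realExt F) (blockChamber p) = blockChamber q := by
  unfold blockChamber PointedCone.map PointedCone.hull
  rw [Submodule.map_span, ← h, Finset.coe_image, ← Set.image_comp, ← Set.image_comp]
  congr 1
  exact Set.image_congr fun v _ => realExt_intVec F v

/-- The rays which are left out of the chambers of the chamber complex. -/
def chamberPosition : Fin 18 → Fin 2 × (Fin 2 → Fin 3) :=
  ![(1, ![2, 2]), (1, ![1, 1]), (1, ![0, 0]), (0, ![2, 2]), (0, ![1, 1]), (0, ![0, 0]),
    (1, ![1, 2]), (1, ![2, 1]), (1, ![2, 0]), (1, ![0, 2]), (1, ![1, 0]), (1, ![0, 1]),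
    (0, ![1, 2]), (0, ![2, 1]), (0, ![1, 0]), (0, ![0, 1]), (0, ![2, 0]), (0, ![0, 2])]

theorem chamberPosition_surjective : Function.Surjective chamberPosition := by
  decide +kernel

theorem image_chamberGens (i : Fin 18) :
    Finset.univ.image (chamberGens i) = chamberRays (chamberPosition i) := by
  revert i
  decide +kernel

theorem chamber_eq_blockChamber (i : Fin 18) : chamber i = blockChamber (chamberPosition i) := by
  unfold chamber blockChamber
  rw [← image_chamberGens, Finset.coe_image, Finset.coe_univ, Set.image_univ, ← Set.range_comp]
  rfl

theorem chambers_eq_range_blockChamber : chambers = Set.range blockChamber := by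
  rw [chambers, funext chamber_eq_blockChamber]
  exact chamberPosition_surjective.range_comp blockChamber

/-- A linear form which is nonnegative on the generators of a cone is nonnegative on the cone. -/
theorem nonneg_of_intVec_mem_hull (φ : (Fin 6 → ℤ) →ₗ[ℤ] ℤ) {A : Set (Fin 6 → ℤ)}
    (hA : ∀ v ∈ A, 0 ≤ φ v) {v : Fin 6 → ℤ} (hv : intVec v ∈ PointedCone.hull ℝ (intVec '' A)) :
    0 ≤ φ v := by
  have hφ : ∀ v, ∑ m, intVec v m * (φ (Pi.single m 1) : ℝ) = (φ v : ℝ) := by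
    intro v
    conv_rhs => rw [φ.pi_apply_eq_sum_univ v]
    push_cast
    refine Finset.sum_congr rfl fun m _ => ?_
    rw [smul_eq_mul, Int.cast_mul]
    congr 3
    ext j
    simp [Pi.single_apply, eq_comm]
  have key : ∀ x ∈ PointedCone.hull ℝ (intVec '' A), 0 ≤ ∑ m, x m * (φ (Pi.single m 1) : ℝ) := by
    intro x hx
    induction hx using Submodule.span_induction with
    | mem x h =>
      obtain ⟨v, hv, rfl⟩ := h
      rw [hφ]
      exact_mod_cast hA v hv
    | zero => simp
    | add x y _ _ hx hy =>
      simp only [Pi.add_apply, add_mul, Finset.sum_add_distrib]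
      exact add_nonneg hx hy
    | smul c x _ hx =>
      have e : ∑ m, (c • x) m * (φ (Pi.single m 1) : ℝ) =
          c.1 * ∑ m, x m * (φ (Pi.single m 1) : ℝ) := by
        rw [Finset.mul_sum]
        exact Finset.sum_congr rfl fun m _ => mul_assoc _ _ _
      rw [e]
      exact mul_nonneg c.2 hx
  have := key _ hv
  rw [hφ] at this
  exact_mod_cast this

/-- The linear form which gives the multiplicity of `b` on a chamber. -/
def chamberForm (p : Fin 2 × (Fin 2 → Fin 3)) : (Fin 6 → ℤ) →ₗ[ℤ] ℤ :=
  (LinearMap.proj (.inl p.1) + (LinearMap.proj (.inr (0, p.2 0)) +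
    LinearMap.proj (.inr (1, p.2 1)))) ∘ₗ rayCoeff

theorem chamberForm_rayB (p : Fin 2 × (Fin 2 → Fin 3)) : chamberForm p rayB = 1 := by
  revert p
  decide +kernel

theorem chamberForm_ray (p : Fin 2 × (Fin 2 → Fin 3)) (k : RayIndex) :
    chamberForm p (ray k) = if k = .inl p.1 ∨ ∃ i, k = .inr (i, p.2 i) then 1 else 0 := by
  revert p k
  decide +kernel

theorem blockChamber_injective : Function.Injective blockChamber := by
  intro p q h
  have key : ∀ k : RayIndex, (k = .inl p.1 ∨ ∃ i, k = .inr (i, p.2 i)) →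
      (k = .inl q.1 ∨ ∃ i, k = .inr (i, q.2 i)) := by
    intro k hk
    by_contra hk'
    have hmem : intVec (ray k) ∈ blockChamber p := by
      rw [h]
      refine PointedCone.subset_hull (Set.mem_image_of_mem _ ?_)
      push Not at hk'
      exact Finset.mem_insert_of_mem (Finset.mem_image_of_mem _ (by simpa using hk'))
    -- This difference of forms is nonnegative on the chamber at `p`, where the form of `p` vanishes
    -- on every generator but `b`. On a ray omitted at `p` but kept at `q` it equals `-1`.
    have := nonneg_of_intVec_mem_hull (chamberForm q - chamberForm p) (A := chamberRays p) (by
      intro v hv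
      rw [Finset.mem_coe, chamberRays, Finset.mem_insert, Finset.mem_image] at hv
      rw [LinearMap.sub_apply]
      rcases hv with rfl | ⟨l, hl, rfl⟩
      · rw [chamberForm_rayB, chamberForm_rayB, sub_self]
      · rw [Finset.mem_filter] at hl
        rw [chamberForm_ray p, if_neg (by push Not; exact hl.2), sub_zero, chamberForm_ray]
        split_ifs <;> omega) hmem
    rw [LinearMap.sub_apply, chamberForm_ray, chamberForm_ray, if_neg hk', if_pos hk] at this
    omega
  refine Prod.ext ?_ (funext fun i => ?_)
  · simpa using key (.inl p.1) (Or.inl rfl)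
  · simpa using key (.inr (i, p.2 i)) (Or.inr ⟨i, rfl⟩)

theorem ncard_chambers : chambers.ncard = 18 := by
  rw [chambers_eq_range_blockChamber, ← Set.image_univ, Set.ncard_image_of_injective _
    blockChamber_injective, Set.ncard_univ, Nat.card_prod, Nat.card_fun]
  simp only [Nat.card_eq_fintype_card, Fintype.card_fin]
  rfl

namespace BlockGroup

/-- The ray `b` is the sum of the block `{c, f}`, which is preserved. -/
theorem toLinearEquiv_rayB (g : BlockGroup) : toLinearEquiv g rayB = rayB := by
  obtain ⟨a, ha⟩ : ∃ a, a = g.1 0 := ⟨_, rfl⟩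
  obtain ⟨b, hb⟩ : ∃ b, b = g.1 1 := ⟨_, rfl⟩
  have hab : a ≠ b := by rw [ha, hb]; exact g.1.injective.ne (by decide)
  have h := (by decide : ∀ a b : Fin 2, a ≠ b → rayB = ray (.inl a) + ray (.inl b))
  rw [h 0 1 (by decide), map_add, toLinearEquiv_ray, toLinearEquiv_ray, toPerm_inl, toPerm_inl,
    ← ha, ← hb, ← h a b hab, ← h 0 1 (by decide)]

/-- The action on the chambers, in terms of the rays which are left out. -/
def actPosition (g : BlockGroup) (p : Fin 2 × (Fin 2 → Fin 3)) : Fin 2 × (Fin 2 → Fin 3) :=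
  (g.1 p.1, fun i => g.2.left i (p.2 (g.2.right.symm i)))

theorem map_blockChamber (g : BlockGroup) (p : Fin 2 × (Fin 2 → Fin 3)) :
    PointedCone.map (realExt (toLinearEquiv g)) (blockChamber p) =
      blockChamber (actPosition g p) := by
  apply map_realExt_blockChamber
  unfold chamberRays
  rw [Finset.image_insert, toLinearEquiv_rayB, Finset.image_image,
    show (toLinearEquiv g : (Fin 6 → ℤ) → Fin 6 → ℤ) ∘ ray = ray ∘ toPerm g from
      funext (toLinearEquiv_ray g), ← Finset.image_image]
  congr 2
  have h : ∀ k, (toPerm g k ≠ .inl (actPosition g p).1 ∧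
      ∀ i, toPerm g k ≠ .inr (i, (actPosition g p).2 i)) ↔
      (k ≠ .inl p.1 ∧ ∀ i, k ≠ .inr (i, p.2 i)) := by
    rintro (a | ⟨i, j⟩)
    · simp [actPosition]
    · simp [actPosition]
  ext k
  rw [Finset.mem_image]
  constructor
  · rintro ⟨l, hl, rfl⟩
    rw [Finset.mem_filter] at hl ⊢
    exact ⟨Finset.mem_univ _, (h l).2 hl.2⟩
  · intro hk
    refine ⟨(toPerm g).symm k, ?_, (toPerm g).apply_symm_apply k⟩
    rw [Finset.mem_filter] at hk ⊢
    refine ⟨Finset.mem_univ _, (h _).1 ?_⟩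
    rw [(toPerm g).apply_symm_apply]
    exact hk.2

theorem exists_actPosition_eq (p q : Fin 2 × (Fin 2 → Fin 3)) : ∃ g, actPosition g p = q :=
  ⟨(Equiv.swap p.1 q.1, ⟨fun i => Equiv.swap (p.2 i) (q.2 i), 1⟩),
    Prod.ext (Equiv.swap_apply_left _ _) (funext fun _ => Equiv.swap_apply_left _ _)⟩

end BlockGroup

/-! ### Known symmetries and generation -/

/-- A decision procedure for equality which reduces well, unlike the derived one. -/
instance S3WrS2.decidableEq : DecidableEq S3WrS2 := fun g h =>
  decidable_of_iff (g.left = h.left ∧ g.right = h.right) SemidirectProduct.ext_iff.symm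

namespace BlockGroup

/-- The element of `S₂ × (S₃ ≀ S₂)` corresponding to the symmetry `S`. -/
def elemS : BlockGroup := (1, ⟨1, Equiv.swap 0 1⟩)

/-- The element of `S₂ × (S₃ ≀ S₂)` corresponding to the symmetry `U`. -/
def elemU : BlockGroup := (1, ⟨![finRotate 3, (finRotate 3)⁻¹], Equiv.swap 0 1⟩)

/-- The element of `S₂ × (S₃ ≀ S₂)` corresponding to the symmetry `T`. -/
def elemT : BlockGroup := (Equiv.swap 0 1, ⟨fun _ => Equiv.swap 1 2, Equiv.swap 0 1⟩)

/-- The element of `S₂ × (S₃ ≀ S₂)` corresponding to the symmetry `X`. -/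
def elemX : BlockGroup := (1, ⟨![1, Equiv.swap 1 2], 1⟩)

theorem toLinearEquiv_elemS : toLinearEquiv elemS = symS :=
  linearEquiv_ext_ray fun k => (toLinearEquiv_ray _ k).trans (by revert k; decide +kernel)

theorem toLinearEquiv_elemU : toLinearEquiv elemU = symU :=
  linearEquiv_ext_ray fun k => (toLinearEquiv_ray _ k).trans (by revert k; decide +kernel)

theorem toLinearEquiv_elemT : toLinearEquiv elemT = symT :=
  linearEquiv_ext_ray fun k => (toLinearEquiv_ray _ k).trans (by revert k; decide +kernel)

theorem toLinearEquiv_elemX : toLinearEquiv elemX = symX :=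
  linearEquiv_ext_ray fun k => (toLinearEquiv_ray _ k).trans (by revert k; decide +kernel)

/-- Parametrization of the subgroup corresponding to the known symmetries. -/
def knownElem (p : Equiv.Perm (Fin 3) × Equiv.Perm (Fin 2)) : BlockGroup :=
  (if Equiv.Perm.sign p.1 = 1 then 1 else Equiv.swap 0 1,
    ⟨![p.1, Equiv.swap 1 2 * p.1 * Equiv.swap 1 2], p.2⟩)

theorem knownElem_injective : Function.Injective knownElem := by
  intro p q h
  refine Prod.ext ?_ (congrArg (fun g : BlockGroup => g.2.right) h)
  exact congrFun (congrArg (fun g : BlockGroup => g.2.left) h) 0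

/-- The subgroup of `S₂ × (S₃ ≀ S₂)` corresponding to the known symmetries. -/
def knownSubgroup : Subgroup BlockGroup where
  carrier := Set.range knownElem
  one_mem' := ⟨1, by decide +kernel⟩
  mul_mem' := by
    rintro _ _ ⟨⟨p, σ⟩, rfl⟩ ⟨⟨q, τ⟩, rfl⟩
    -- Moving the block swap past `q` exchanges its two components, which are conjugate under `swap
    -- 1 2`.
    refine ⟨(p * if σ = 1 then q else Equiv.swap 1 2 * q * Equiv.swap 1 2, σ * τ), ?_⟩
    revert p q σ τ
    decide +kernel
  inv_mem' := by
    rintro _ ⟨⟨p, σ⟩, rfl⟩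
    refine ⟨(if σ = 1 then p⁻¹ else Equiv.swap 1 2 * p⁻¹ * Equiv.swap 1 2, σ), ?_⟩
    revert p σ
    decide +kernel

theorem card_knownSubgroup : Nat.card knownSubgroup = 12 := by
  refine (Nat.card_congr (Equiv.ofInjective _ knownElem_injective)).symm.trans ?_
  rw [Nat.card_prod]
  simp only [Nat.card_eq_fintype_card, Fintype.card_perm, Fintype.card_fin]
  rfl

theorem closure_eq_knownSubgroup : Subgroup.closure {elemS, elemU, elemT} = knownSubgroup := by
  refine le_antisymm ((Subgroup.closure_le _).2 ?_) ?_
  · rintro _ (rfl | rfl | rfl)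
    · exact ⟨(1, Equiv.swap 0 1), by decide +kernel⟩
    · exact ⟨(finRotate 3, Equiv.swap 0 1), by decide +kernel⟩
    · exact ⟨(Equiv.swap 1 2, Equiv.swap 0 1), by decide +kernel⟩
  · rintro _ ⟨p, rfl⟩
    obtain ⟨i, j, k, h⟩ := (by decide +kernel :
      ∀ p : Equiv.Perm (Fin 3) × Equiv.Perm (Fin 2), ∃ (i : Fin 3) (j k : Fin 2), knownElem p =
        (elemU * elemS) ^ (i : ℕ) * (elemT * elemS) ^ (j : ℕ) * elemS ^ (k : ℕ)) p
    have hS := Subgroup.subset_closure (show elemS ∈ ({elemS, elemU, elemT} : Set _) by simp)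
    have hU := Subgroup.subset_closure (show elemU ∈ ({elemS, elemU, elemT} : Set _) by simp)
    have hT := Subgroup.subset_closure (show elemT ∈ ({elemS, elemU, elemT} : Set _) by simp)
    rw [h]
    exact mul_mem (mul_mem (pow_mem (mul_mem hU hS) _) (pow_mem (mul_mem hT hS) _)) (pow_mem hS _)

theorem closure_eq_top : Subgroup.closure {elemS, elemU, elemT, elemX} = ⊤ := by
  rw [eq_top_iff]
  rintro ⟨ε, ⟨f, τ⟩⟩ -
  set K := Subgroup.closure {elemS, elemU, elemT, elemX} with hK
  have hS : elemS ∈ K := Subgroup.subset_closure (by simp)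
  have hU : elemU ∈ K := Subgroup.subset_closure (by simp)
  have hT : elemT ∈ K := Subgroup.subset_closure (by simp)
  have hX : elemX ∈ K := Subgroup.subset_closure (by simp)
  have h0 : ∀ p : Equiv.Perm (Fin 3), ((1, ⟨![p, 1], 1⟩) : BlockGroup) ∈ K := by
    intro p
    -- `elemU * elemS` rotates the two blocks in opposite senses. Conjugation by `elemX` reverses
    -- the second rotation, so the product acts on the first block only. Conjugating `elemX` by
    -- `elemS` gives a transposition there.
    obtain ⟨i, j, h⟩ := (by decide +kernel :
      ∀ p : Equiv.Perm (Fin 3), ∃ (i : Fin 3) (j : Fin 2), ((1, ⟨![p, 1], 1⟩) : BlockGroup) =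
        (elemX * (elemU * elemS) * elemX * (elemU * elemS)) ^ (i : ℕ) *
          (elemS * elemX * elemS) ^ (j : ℕ)) p
    rw [h]
    exact mul_mem (pow_mem (mul_mem (mul_mem (mul_mem hX (mul_mem hU hS)) hX) (mul_mem hU hS)) _)
      (pow_mem (mul_mem (mul_mem hS hX) hS) _)
  have h1 : ∀ p : Equiv.Perm (Fin 3), ((1, ⟨![1, p], 1⟩) : BlockGroup) ∈ K := by
    intro p
    have h := (by decide +kernel : ∀ p : Equiv.Perm (Fin 3), ((1, ⟨![1, p], 1⟩) : BlockGroup) =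
      elemS * (1, ⟨![p, 1], 1⟩) * elemS) p
    rw [h]
    exact mul_mem (mul_mem hS (h0 p)) hS
  have hε : ((ε, 1) : BlockGroup) ∈ K := by
    -- `elemT * elemS` swaps `c` and `f` and applies `swap 1 2` in both blocks of three; the
    -- remaining factors undo the latter.
    obtain ⟨i, h⟩ := (by decide +kernel : ∀ ε : Equiv.Perm (Fin 2), ∃ i : Fin 2,
      ((ε, 1) : BlockGroup) = (elemT * elemS * elemX * (elemS * elemX * elemS)) ^ (i : ℕ)) ε
    rw [h]
    exact pow_mem (mul_mem (mul_mem (mul_mem hT hS) hX) (mul_mem (mul_mem hS hX) hS)) _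
  have hτ : ((1, ⟨1, τ⟩) : BlockGroup) ∈ K := by
    obtain ⟨i, h⟩ := (by decide +kernel : ∀ τ : Equiv.Perm (Fin 2), ∃ i : Fin 2,
      ((1, ⟨1, τ⟩) : BlockGroup) = elemS ^ (i : ℕ)) τ
    rw [h]
    exact pow_mem hS _
  have e : ((ε, ⟨f, τ⟩) : BlockGroup) =
      (ε, 1) * (1, ⟨![f 0, 1], 1⟩) * (1, ⟨![1, f 1], 1⟩) * (1, ⟨1, τ⟩) := by
    refine Prod.ext (by simp) (SemidirectProduct.ext (funext fun i => ?_) (by simp))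
    fin_cases i <;> simp
  rw [e]
  exact mul_mem (mul_mem (mul_mem hε (h0 _)) (h1 _)) hτ

theorem map_knownSubgroup : knownSubgroup.map toLinearEquiv = knownSymmetries := by
  rw [← closure_eq_knownSubgroup, MonoidHom.map_closure, knownSymmetries]
  simp only [Set.image_insert_eq, Set.image_singleton, toLinearEquiv_elemS, toLinearEquiv_elemU,
    toLinearEquiv_elemT]

theorem knownSymmetries_sup_closure : knownSymmetries ⊔ Subgroup.closure {symX} = lrSymmetries := by
  rw [knownSymmetries, ← Subgroup.closure_union, ← range_toLinearEquiv, MonoidHom.range_eq_map,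
    ← closure_eq_top, MonoidHom.map_closure]
  simp only [Set.image_insert_eq, Set.image_singleton, toLinearEquiv_elemS, toLinearEquiv_elemU,
    toLinearEquiv_elemT, toLinearEquiv_elemX, Set.insert_union, Set.singleton_union]

end BlockGroup

theorem theorem1 :
    -- the group of linear symmetries of `C` has order 144
    Nat.card lrSymmetries = 144 ∧
    -- it is isomorphic to `S₂ × (S₃ ≀ S₂)`
    Nonempty (lrSymmetries ≃* Equiv.Perm (Fin 2) × S3WrS2) ∧
    -- it acts on the set of the 18 chambers, and this action is transitive
    (chambers.ncard = 18 ∧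
      (∀ F ∈ lrSymmetries, ∀ κ ∈ chambers, PointedCone.map (realExt F) κ ∈ chambers) ∧
      (∀ κ ∈ chambers, ∀ κ' ∈ chambers,
        ∃ F ∈ lrSymmetries, PointedCone.map (realExt F) κ = κ')) ∧
    -- it is generated by the group of the 12 known symmetries together with `X`
    (Nat.card knownSymmetries = 12 ∧
      knownSymmetries ⊔ Subgroup.closure {symX} = lrSymmetries) := by
  refine ⟨(Nat.card_congr BlockGroup.lrSymmetriesEquiv.toEquiv).trans BlockGroup.card_eq,
    ⟨BlockGroup.lrSymmetriesEquiv⟩, ⟨ncard_chambers, ?_, ?_⟩, ?_,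
    BlockGroup.knownSymmetries_sup_closure⟩
  · intro F hF κ hκ
    rw [chambers_eq_range_blockChamber] at hκ ⊢
    obtain ⟨g, rfl⟩ := BlockGroup.mem_lrSymmetries_iff.1 hF
    obtain ⟨p, rfl⟩ := hκ
    exact ⟨_, (g.map_blockChamber p).symm⟩
  · intro κ hκ κ' hκ'
    rw [chambers_eq_range_blockChamber] at hκ hκ'
    obtain ⟨p, rfl⟩ := hκ
    obtain ⟨q, rfl⟩ := hκ'
    obtain ⟨g, rfl⟩ := BlockGroup.exists_actPosition_eq p q
    exact ⟨_, g.toLinearEquiv_mem, g.map_blockChamber p⟩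
  · rw [← BlockGroup.map_knownSubgroup, Subgroup.card_map_of_injective
      BlockGroup.toLinearEquiv_injective, BlockGroup.card_knownSubgroup]
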